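/- Let $g\colon[0,1]\to[0,1]$ be the continuous map $$g(x)=\begin{cases}2x+\tfrac12 & \text{if } 0\le x\le \tfrac14,\\ \tfrac32-2x & \text{if } \tfrac14\le x\le\tfrac12,\\ 1-x & \text{if } \tfrac12\le x\le 1.\end{cases}$$ Then $g([0,\frac12])=[\frac12,1]$, $g([\frac12,1])=[0,\frac12]$, and $g$ is a "square root" of the tent map $T(t)=\min(2t,2-2t)$ in the sense that for all $t\in[0,1]$ $$g^2\Bigl(\frac{1+t}{2}\Bigr)=\frac{1+T(t)}{2},\qquad g^2\Bigl(\frac{1-t}{2}\Bigr)=\frac{1-T(t)}{2}.$$ Moreover: * $g$ is topologically transitive: for all non-empty open sets $U,V\subset[0,1]$ there is $n\ge1$ with $g^n(U)\cap V\ne\emptyset$; * $g$ is generically chaotic and densely chaotic, that is, the set of pairs $(x,y)\in[0,1]^2$ with $\limsup_{n\to\infty}|g^n(x)-g^n(y)|>0$ and $\liminf_{n\to\infty}|g^n(x)-g^n(y)|=0$ is residual, respectively dense, in $[0,1]^2$; * $g$ is of type exactly $6$ for Sharkovskiĭ's order $3\lhd5\lhd7\lhd\cdots\lhd2\cdot3\lhd2\cdot5\lhd\cdots\lhd2^2\cdot3\lhd2^2\cdot5\lhd\cdots\lhd2^3\lhd2^2\lhd2\lhd1$,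 that is, the set of least periods of the periodic points of $g$ is $\{m\ge1 \mid m=6\text{ or }6\lhd m\}$; * the topological entropy of $g$ is $h_{top}(g)=\frac{\log 2}{2}$. In particular, there is a generically (hence densely) chaotic interval map of type exactly $6$ and of topological entropy exactly $\frac{\log 2}{2}$. -/

import Mathlib

namespace DenseChaos

/-! ### Chaos and transitivity for a self-map of a metric space -/

section Dynamics

variable {X : Type*}

/-- `(x, y)` is a Li-Yorke pair of modulus `δ` for `T`. The distances are taken in `[0, ∞]`, so
that the upper and lower limits always exist. -/
def IsLiYorkePairOfModulus [MetricSpace X] (T : X → X) (δ : ℝ) (x y : X) : Prop :=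
  ENNReal.ofReal δ < Filter.limsup (fun n : ℕ => edist (T^[n] x) (T^[n] y)) Filter.atTop ∧
    Filter.liminf (fun n : ℕ => edist (T^[n] x) (T^[n] y)) Filter.atTop = 0

/-- The set of Li-Yorke pairs of `T`: the pairs that are Li-Yorke of modulus `δ` for some
`δ > 0`. -/
def liYorkePairs [MetricSpace X] (T : X → X) : Set (X × X) :=
  {p | ∃ δ : ℝ, 0 < δ ∧ IsLiYorkePairOfModulus T δ p.1 p.2}

/-- `T` is generically chaotic: the set of Li-Yorke pairs is residual in `X × X`. -/
def GenericallyChaotic [MetricSpace X] (T : X → X) : Prop :=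
  liYorkePairs T ∈ residual (X × X)

/-- `T` is densely chaotic: the set of Li-Yorke pairs is dense in `X × X`. -/
def DenselyChaotic [MetricSpace X] (T : X → X) : Prop :=
  Dense (liYorkePairs T)

/-- `T` is (topologically) transitive. -/
def IsTransitiveMap [TopologicalSpace X] (T : X → X) : Prop :=
  ∀ U V : Set X, IsOpen U → U.Nonempty → IsOpen V → V.Nonempty →
    ∃ n : ℕ, 0 < n ∧ ((T^[n] '' U) ∩ V).Nonempty

/-! ### Sharkovskii's order and types -/

/-- The exponent `a` in `n = 2 ^ a * p` with `p` odd (for `n ≥ 1`). -/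
def twoExp (n : ℕ) : ℕ := padicValNat 2 n

/-- The odd factor `p` in `n = 2 ^ a * p` (for `n ≥ 1`). -/
def oddFactor (n : ℕ) : ℕ := n / 2 ^ twoExp n

/-- `SharkovskiiLT n m` means that `n` strictly precedes `m` in Sharkovskii's order
`3 ◁ 5 ◁ 7 ◁ ⋯ ◁ 2·3 ◁ 2·5 ◁ ⋯ ◁ 2²·3 ◁ 2²·5 ◁ ⋯ ◁ 2³ ◁ 2² ◁ 2 ◁ 1` of the positive integers.
The three cases: neither number is a power of `2`; only `m` is; both are. -/
def SharkovskiiLT (n m : ℕ) : Prop :=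
  (oddFactor n ≠ 1 ∧ oddFactor m ≠ 1 ∧
      (twoExp n < twoExp m ∨ (twoExp n = twoExp m ∧ oddFactor n < oddFactor m))) ∨
    (oddFactor n ≠ 1 ∧ oddFactor m = 1) ∨
    (oddFactor n = 1 ∧ oddFactor m = 1 ∧ twoExp m < twoExp n)

/-- The set of (least) periods of the periodic points of `f`. -/
def periodSet (f : X → X) : Set ℕ :=
  {m | 0 < m ∧ ∃ x : X, Function.minimalPeriod f x = m}

/-- `f` is of type `n` (a positive integer) for Sharkovskii's order: the periods of `f` are
exactly the positive integers `m` with `m = n` or `n ◁ m`. -/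
def HasSharkovskiiType (f : X → X) (n : ℕ) : Prop :=
  0 < n ∧ periodSet f = {m | 0 < m ∧ (m = n ∨ SharkovskiiLT n m)}

end Dynamics

/-! ### The tent map and its square root -/

/-- The tent map (used for `0 ≤ t ≤ 1`). -/
noncomputable def tentMap (t : ℝ) : ℝ := min (2 * t) (2 - 2 * t)

/-- The formula of the square root of the tent map, for `0 ≤ x ≤ 1`. -/
noncomputable def sqrtTentFun (x : ℝ) : ℝ :=
  if x ≤ 1 / 4 then 2 * x + 1 / 2 else if x ≤ 1 / 2 then 3 / 2 - 2 * x else 1 - x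

theorem continuous_sqrtTentFun : Continuous sqrtTentFun := by
  unfold sqrtTentFun
  refine Continuous.if_le (by fun_prop) ?_ continuous_id continuous_const ?_
  · refine Continuous.if_le (by fun_prop) (by fun_prop) continuous_id continuous_const ?_
    intro x hx
    subst hx
    norm_num
  · intro x hx
    subst hx
    norm_num

theorem sqrtTentFun_mem {x : ℝ} (hx : x ∈ unitInterval) : sqrtTentFun x ∈ unitInterval := by
  obtain ⟨h0, h1⟩ := hx
  unfold sqrtTentFun
  split_ifs <;> constructor <;> linarith

/-- The square root of the tent map, as a continuous map from `[0, 1]` to itself. -/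
noncomputable def sqrtTent : C(unitInterval, unitInterval) where
  toFun x := ⟨sqrtTentFun x, sqrtTentFun_mem x.2⟩
  continuous_toFun := (continuous_sqrtTentFun.comp continuous_subtype_val).subtype_mk _

end DenseChaos

namespace DenseChaos

open Filter Function

/-! ### Elementary properties of the square root of the tent map -/

/-! Write g for the map. It swaps the two halves of the interval, and g² restricted to either half
is a full two-branch map with slopes ±2. Everything follows from these two facts.

The inverse branches of g² contract by 1/2, so high iterates of a nonempty open set cover a whole
half (`exists_half_subset_image`), and one more step covers the other: this is transitivity. Both
halves contain 1/2 and each contains an endpoint of the interval, so two open sets always contain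
points that reach 1/2 together, and points of which one is at 1/2 while the other is at an endpoint.
Baire category turns this into generic, hence dense, chaos.

An odd iterate swaps the halves, so a point of odd period is 1/2, which is fixed; explicit orbits of
the tent map supply all even periods. Together with 1 these are exactly 6 and its successors in
Sharkovskii's order.

The number of distinguishable orbits doubles every two steps, so the entropy is (log 2)/2. The upper
bound pulls back finite covers (`exists_isOrbitCover_card_le`), the lower bound pulls back separated
sets (`exists_isOrbitSeparated`). -/

theorem sqrtTentFun_of_le_quarter {x : ℝ} (h : x ≤ 1 / 4) : sqrtTentFun x = 2 * x + 1 / 2 :=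
  if_pos h

theorem sqrtTentFun_of_mem_middle {x : ℝ} (h : 1 / 4 ≤ x) (h' : x ≤ 1 / 2) :
    sqrtTentFun x = 3 / 2 - 2 * x := by
  unfold sqrtTentFun
  split_ifs <;> linarith

theorem sqrtTentFun_of_half_le {x : ℝ} (h : 1 / 2 ≤ x) : sqrtTentFun x = 1 - x := by
  unfold sqrtTentFun
  split_ifs <;> linarith

theorem half_le_sqrtTentFun {x : ℝ} (h0 : 0 ≤ x) (h : x ≤ 1 / 2) : 1 / 2 ≤ sqrtTentFun x := by
  unfold sqrtTentFun
  split_ifs <;> linarith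

theorem sqrtTentFun_le_half {x : ℝ} (h : 1 / 2 ≤ x) : sqrtTentFun x ≤ 1 / 2 := by
  rw [sqrtTentFun_of_half_le h]
  linarith

theorem sqrtTentFun_sq_first {x : ℝ} (h0 : 0 ≤ x) (h : x ≤ 1 / 4) :
    sqrtTentFun (sqrtTentFun x) = 1 / 2 - 2 * x := by
  rw [sqrtTentFun_of_le_quarter h, sqrtTentFun_of_half_le (by linarith)]
  ring

theorem sqrtTentFun_sq_second {x : ℝ} (h0 : 1 / 4 ≤ x) (h : x ≤ 1 / 2) :
    sqrtTentFun (sqrtTentFun x) = 2 * x - 1 / 2 := by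
  rw [sqrtTentFun_of_mem_middle h0 h, sqrtTentFun_of_half_le (by linarith)]
  ring

theorem sqrtTentFun_sq_third {x : ℝ} (h0 : 1 / 2 ≤ x) (h : x ≤ 3 / 4) :
    sqrtTentFun (sqrtTentFun x) = 2 * x - 1 / 2 := by
  rw [sqrtTentFun_of_half_le h0, sqrtTentFun_of_mem_middle (by linarith) (by linarith)]
  ring

theorem sqrtTentFun_sq_fourth {x : ℝ} (h0 : 3 / 4 ≤ x) :
    sqrtTentFun (sqrtTentFun x) = 5 / 2 - 2 * x := by
  rw [sqrtTentFun_of_half_le (x := x) (by linarith), sqrtTentFun_of_le_quarter (by linarith)]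
  ring

theorem coe_sqrtTent (x : unitInterval) : (sqrtTent x : ℝ) = sqrtTentFun x := rfl

theorem coe_iterate_sqrtTent (n : ℕ) (x : unitInterval) :
    ((sqrtTent^[n] x : unitInterval) : ℝ) = sqrtTentFun^[n] x := by
  induction n generalizing x with
  | zero => rfl
  | succ n ih => rw [iterate_succ_apply, iterate_succ_apply, ih, coe_sqrtTent]

theorem sqrtTent_image_left :
    sqrtTent '' {x : unitInterval | (x : ℝ) ≤ 1 / 2} = {x : unitInterval | 1 / 2 ≤ (x : ℝ)} := by
  ext y
  constructor
  · rintro ⟨x, hx, rfl⟩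
    exact half_le_sqrtTentFun x.2.1 hx
  · intro hy
    have hy' : 1 / 2 ≤ (y : ℝ) := hy
    have h1 := y.2.2
    have hx : (y : ℝ) / 2 - 1 / 4 ≤ 1 / 4 := by linarith
    refine ⟨⟨(y : ℝ) / 2 - 1 / 4, by linarith, by linarith⟩, ?_, ?_⟩
    · change (y : ℝ) / 2 - 1 / 4 ≤ 1 / 2
      linarith
    · ext
      rw [coe_sqrtTent, sqrtTentFun_of_le_quarter hx]
      ring

theorem sqrtTent_image_right :
    sqrtTent '' {x : unitInterval | 1 / 2 ≤ (x : ℝ)} = {x : unitInterval | (x : ℝ) ≤ 1 / 2} := by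
  ext y
  constructor
  · rintro ⟨x, hx, rfl⟩
    exact sqrtTentFun_le_half hx
  · intro hy
    have hy' : (y : ℝ) ≤ 1 / 2 := hy
    have h0 := y.2.1
    have hx : 1 / 2 ≤ 1 - (y : ℝ) := by linarith
    refine ⟨⟨1 - (y : ℝ), by linarith, by linarith⟩, hx, ?_⟩
    ext
    rw [coe_sqrtTent, sqrtTentFun_of_half_le hx]
    ring

theorem sqrtTent_sq_right (t x : unitInterval) (h : (x : ℝ) = (1 + t) / 2) :
    (sqrtTent (sqrtTent x) : ℝ) = (1 + tentMap t) / 2 := by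
  have h0 := t.2.1
  have h1 := t.2.2
  rw [coe_sqrtTent, coe_sqrtTent, h, tentMap]
  rcases le_total (t : ℝ) (1 / 2) with ht | ht
  · rw [min_eq_left (by linarith), sqrtTentFun_sq_third (by linarith) (by linarith)]
    ring
  · rw [min_eq_right (by linarith), sqrtTentFun_sq_fourth (by linarith)]
    ring

theorem sqrtTent_sq_left (t x : unitInterval) (h : (x : ℝ) = (1 - t) / 2) :
    (sqrtTent (sqrtTent x) : ℝ) = (1 - tentMap t) / 2 := by
  have h0 := t.2.1
  have h1 := t.2.2
  rw [coe_sqrtTent, coe_sqrtTent, h, tentMap]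
  rcases le_total (t : ℝ) (1 / 2) with ht | ht
  · rw [min_eq_left (by linarith), sqrtTentFun_sq_second (by linarith) (by linarith)]
    ring
  · rw [min_eq_right (by linarith), sqrtTentFun_sq_first (by linarith) (by linarith)]
    ring

/-! ### Images of open sets -/

/-- Follow the orbit of `x` under g² and pull `z` back along the inverse branches it selects; each
of them halves distances. -/
theorem exists_sqrtTentFun_iterate_eq_right (q : ℕ) {x z : ℝ} (hx : x ∈ Set.Icc (1 / 2 : ℝ) 1)
    (hz : z ∈ Set.Icc (1 / 2 : ℝ) 1) :
    ∃ y ∈ Set.Icc (1 / 2 : ℝ) 1, |y - x| ≤ (1 / 2) ^ q ∧ sqrtTentFun^[2 * q] y = z := by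
  induction q generalizing x with
  | zero =>
    refine ⟨z, hz, ?_, rfl⟩
    rw [pow_zero, abs_le]
    constructor <;> linarith [hx.1, hx.2, hz.1, hz.2]
  | succ q ih =>
    obtain ⟨h0, h1⟩ := hx
    rcases le_total x (3 / 4) with h | h
    · obtain ⟨y, ⟨hy0, hy1⟩, hd, hy⟩ := ih (x := 2 * x - 1 / 2) ⟨by linarith, by linarith⟩
      refine ⟨1 / 4 + y / 2, ⟨by linarith, by linarith⟩, ?_, ?_⟩
      · rw [pow_succ]
        rw [abs_le] at hd ⊢
        constructor <;> linarith
      · rw [mul_add_one, iterate_add_apply]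
        change sqrtTentFun^[2 * q] (sqrtTentFun (sqrtTentFun _)) = z
        rw [sqrtTentFun_sq_third (by linarith) (by linarith), ← hy]
        ring_nf
    · obtain ⟨y, ⟨hy0, hy1⟩, hd, hy⟩ := ih (x := 5 / 2 - 2 * x) ⟨by linarith, by linarith⟩
      refine ⟨5 / 4 - y / 2, ⟨by linarith, by linarith⟩, ?_, ?_⟩
      · rw [pow_succ]
        rw [abs_le] at hd ⊢
        constructor <;> linarith
      · rw [mul_add_one, iterate_add_apply]
        change sqrtTentFun^[2 * q] (sqrtTentFun (sqrtTentFun _)) = z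
        rw [sqrtTentFun_sq_fourth (by linarith), ← hy]
        ring_nf

theorem exists_sqrtTentFun_iterate_eq_left (q : ℕ) {x z : ℝ} (hx : x ∈ Set.Icc (0 : ℝ) (1 / 2))
    (hz : z ∈ Set.Icc (0 : ℝ) (1 / 2)) :
    ∃ y ∈ Set.Icc (0 : ℝ) (1 / 2), |y - x| ≤ (1 / 2) ^ q ∧ sqrtTentFun^[2 * q] y = z := by
  induction q generalizing x with
  | zero =>
    refine ⟨z, hz, ?_, rfl⟩
    rw [pow_zero, abs_le]
    constructor <;> linarith [hx.1, hx.2, hz.1, hz.2]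
  | succ q ih =>
    obtain ⟨h0, h1⟩ := hx
    rcases le_total (1 / 4) x with h | h
    · obtain ⟨y, ⟨hy0, hy1⟩, hd, hy⟩ := ih (x := 2 * x - 1 / 2) ⟨by linarith, by linarith⟩
      refine ⟨1 / 4 + y / 2, ⟨by linarith, by linarith⟩, ?_, ?_⟩
      · rw [pow_succ]
        rw [abs_le] at hd ⊢
        constructor <;> linarith
      · rw [mul_add_one, iterate_add_apply]
        change sqrtTentFun^[2 * q] (sqrtTentFun (sqrtTentFun _)) = z
        rw [sqrtTentFun_sq_second (by linarith) (by linarith), ← hy]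
        ring_nf
    · obtain ⟨y, ⟨hy0, hy1⟩, hd, hy⟩ := ih (x := 1 / 2 - 2 * x) ⟨by linarith, by linarith⟩
      refine ⟨1 / 4 - y / 2, ⟨by linarith, by linarith⟩, ?_, ?_⟩
      · rw [pow_succ]
        rw [abs_le] at hd ⊢
        constructor <;> linarith
      · rw [mul_add_one, iterate_add_apply]
        change sqrtTentFun^[2 * q] (sqrtTentFun (sqrtTentFun _)) = z
        rw [sqrtTentFun_sq_first (by linarith) (by linarith), ← hy]
        ring_nf

theorem image_succ_left {U : Set unitInterval} {n : ℕ}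
    (h : {z : unitInterval | 1 / 2 ≤ (z : ℝ)} ⊆ sqrtTent^[n] '' U) :
    {z : unitInterval | (z : ℝ) ≤ 1 / 2} ⊆ sqrtTent^[n + 1] '' U := by
  rw [iterate_succ', Set.image_comp, ← sqrtTent_image_right]
  exact Set.image_mono h

theorem image_succ_right {U : Set unitInterval} {n : ℕ}
    (h : {z : unitInterval | (z : ℝ) ≤ 1 / 2} ⊆ sqrtTent^[n] '' U) :
    {z : unitInterval | 1 / 2 ≤ (z : ℝ)} ⊆ sqrtTent^[n + 1] '' U := by
  rw [iterate_succ', Set.image_comp, ← sqrtTent_image_left]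
  exact Set.image_mono h

/-- Large iterates of a nonempty open set cover one of the two halves of the interval. -/
theorem exists_half_subset_image {U : Set unitInterval} (hU : IsOpen U) (hne : U.Nonempty) :
    ∃ N : ℕ, ∀ n ≥ N, {z : unitInterval | 1 / 2 ≤ (z : ℝ)} ⊆ sqrtTent^[n] '' U ∨
      {z : unitInterval | (z : ℝ) ≤ 1 / 2} ⊆ sqrtTent^[n] '' U := by
  obtain ⟨x, hxU⟩ := hne
  obtain ⟨ε, hε, hball⟩ := Metric.isOpen_iff.1 hU x hxU
  obtain ⟨q₀, hq₀⟩ := exists_pow_lt_of_lt_one hε (by norm_num : (1 / 2 : ℝ) < 1)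
  have key : ∀ q ≥ q₀, {z : unitInterval | 1 / 2 ≤ (z : ℝ)} ⊆ sqrtTent^[2 * q] '' U ∨
      {z : unitInterval | (z : ℝ) ≤ 1 / 2} ⊆ sqrtTent^[2 * q] '' U := by
    intro q hq
    have hlt : (1 / 2 : ℝ) ^ q < ε :=
      (pow_le_pow_of_le_one (by norm_num) (by norm_num) hq).trans_lt hq₀
    rcases le_total (1 / 2) (x : ℝ) with hx | hx
    · left
      intro z hz
      obtain ⟨y, hy, hd, hyz⟩ :=
        exists_sqrtTentFun_iterate_eq_right q ⟨hx, x.2.2⟩ ⟨hz, z.2.2⟩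
      refine ⟨⟨y, by linarith [hy.1], hy.2⟩, hball ?_, ?_⟩
      · exact hd.trans_lt hlt
      · ext
        rw [coe_iterate_sqrtTent, hyz]
    · right
      intro z hz
      obtain ⟨y, hy, hd, hyz⟩ :=
        exists_sqrtTentFun_iterate_eq_left q ⟨x.2.1, hx⟩ ⟨z.2.1, hz⟩
      refine ⟨⟨y, hy.1, by linarith [hy.2]⟩, hball ?_, ?_⟩
      · exact hd.trans_lt hlt
      · ext
        rw [coe_iterate_sqrtTent, hyz]
  refine ⟨2 * q₀, fun n hn => ?_⟩
  obtain ⟨q, rfl | rfl⟩ := Nat.even_or_odd' n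
  · exact key q (by omega)
  -- An odd time is one step after an even one, and that step swaps the halves.
  · exact (key q (by omega)).symm.imp image_succ_right image_succ_left

theorem isTransitiveMap_sqrtTent : IsTransitiveMap sqrtTent := by
  rintro U V hU hUne - ⟨v, hv⟩
  obtain ⟨N, hN⟩ := exists_half_subset_image hU hUne
  have h0 := hN (N + 1) (by omega)
  rcases le_total (1 / 2) (v : ℝ) with h | h <;> rcases h0 with h0 | h0
  · exact ⟨N + 1, by omega, v, h0 h, hv⟩
  · exact ⟨N + 2, by omega, v, image_succ_right h0 h, hv⟩
  · exact ⟨N + 2, by omega, v, image_succ_left h0 h, hv⟩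
  · exact ⟨N + 1, by omega, v, h0 h, hv⟩

/-! ### Li-Yorke pairs -/

theorem exists_iterate_eq_half {U : Set unitInterval} {n : ℕ}
    (h : {z : unitInterval | 1 / 2 ≤ (z : ℝ)} ⊆ sqrtTent^[n] '' U ∨
      {z : unitInterval | (z : ℝ) ≤ 1 / 2} ⊆ sqrtTent^[n] '' U) :
    ∃ x ∈ U, ((sqrtTent^[n] x : unitInterval) : ℝ) = 1 / 2 := by
  have hz : (1 / 2 : ℝ) ∈ unitInterval := ⟨by norm_num, by norm_num⟩
  obtain ⟨x, hx, he⟩ : (⟨1 / 2, hz⟩ : unitInterval) ∈ sqrtTent^[n] '' U :=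
    h.elim (fun h => h (le_refl (1 / 2 : ℝ))) (fun h => h (le_refl (1 / 2 : ℝ)))
  exact ⟨x, hx, by rw [he]⟩

theorem exists_half_le_abs_iterate_sub_half {U : Set unitInterval} {n : ℕ}
    (h : {z : unitInterval | 1 / 2 ≤ (z : ℝ)} ⊆ sqrtTent^[n] '' U ∨
      {z : unitInterval | (z : ℝ) ≤ 1 / 2} ⊆ sqrtTent^[n] '' U) :
    ∃ x ∈ U, 1 / 2 ≤ |((sqrtTent^[n] x : unitInterval) : ℝ) - 1 / 2| := by
  rcases h with h | h
  · obtain ⟨x, hx, he⟩ := h (show (1 : unitInterval) ∈ _ from by norm_num)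
    exact ⟨x, hx, by rw [he]; norm_num⟩
  · obtain ⟨x, hx, he⟩ := h (show (0 : unitInterval) ∈ _ from by norm_num)
    exact ⟨x, hx, by rw [he]; norm_num⟩

theorem continuous_edist_iterate (n : ℕ) : Continuous fun p : unitInterval × unitInterval =>
    edist (sqrtTent^[n] p.1) (sqrtTent^[n] p.2) :=
  ((sqrtTent.continuous.iterate n).comp continuous_fst).edist
    ((sqrtTent.continuous.iterate n).comp continuous_snd)

theorem exists_half_subset_image_prod {W : Set (unitInterval × unitInterval)} (hW : IsOpen W)
    (hne : W.Nonempty) : ∃ U V : Set unitInterval, U ×ˢ V ⊆ W ∧ ∃ N : ℕ, ∀ n ≥ N,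
      ({z : unitInterval | 1 / 2 ≤ (z : ℝ)} ⊆ sqrtTent^[n] '' U ∨
        {z : unitInterval | (z : ℝ) ≤ 1 / 2} ⊆ sqrtTent^[n] '' U) ∧
      ({z : unitInterval | 1 / 2 ≤ (z : ℝ)} ⊆ sqrtTent^[n] '' V ∨
        {z : unitInterval | (z : ℝ) ≤ 1 / 2} ⊆ sqrtTent^[n] '' V) := by
  obtain ⟨⟨a, b⟩, hab⟩ := hne
  obtain ⟨U, V, hU, hV, ha, hb, hUV⟩ := isOpen_prod_iff.1 hW a b hab
  obtain ⟨N, hN⟩ := exists_half_subset_image hU ⟨a, ha⟩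
  obtain ⟨M, hM⟩ := exists_half_subset_image hV ⟨b, hb⟩
  exact ⟨U, V, hUV, max N M, fun n hn =>
    ⟨hN n ((le_max_left _ _).trans hn), hM n ((le_max_right _ _).trans hn)⟩⟩

/-- The condition is open by continuity. For density, any box contains a pair whose two points are
both at 1/2 at one common late time. -/
theorem eventually_residual_edist_lt {ε : ENNReal} (hε : 0 < ε) (N : ℕ) :
    ∀ᶠ p : unitInterval × unitInterval in residual _,
      ∃ n ≥ N, edist (sqrtTent^[n] p.1) (sqrtTent^[n] p.2) < ε := by
  refine residual_of_dense_open ?_ ?_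
  · simp only [Set.ofPred_exists, Set.ofPred_and]
    exact isOpen_iUnion fun n => isOpen_const.inter
      (isOpen_lt (continuous_edist_iterate n) continuous_const)
  · rw [dense_iff_inter_open]
    intro W hW hne
    obtain ⟨U, V, hUV, M, hM⟩ := exists_half_subset_image_prod hW hne
    obtain ⟨h1, h2⟩ := hM (max N M) (le_max_right _ _)
    obtain ⟨x, hx, hx'⟩ := exists_iterate_eq_half h1
    obtain ⟨y, hy, hy'⟩ := exists_iterate_eq_half h2
    refine ⟨(x, y), hUV ⟨hx, hy⟩, max N M, le_max_left _ _, ?_⟩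
    have : sqrtTent^[max N M] x = sqrtTent^[max N M] y := Subtype.ext (hx'.trans hy'.symm)
    simpa [this] using hε

/-- Density: at a common late time one point of the box sits at an endpoint of the interval and the
other at 1/2, so their distance is at least 1/2. -/
theorem eventually_residual_lt_edist (N : ℕ) :
    ∀ᶠ p : unitInterval × unitInterval in residual _,
      ∃ n ≥ N, ENNReal.ofReal (1 / 4) < edist (sqrtTent^[n] p.1) (sqrtTent^[n] p.2) := by
  refine residual_of_dense_open ?_ ?_
  · simp only [Set.ofPred_exists, Set.ofPred_and]
    exact isOpen_iUnion fun n => isOpen_const.inter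
      (isOpen_lt continuous_const (continuous_edist_iterate n))
  · rw [dense_iff_inter_open]
    intro W hW hne
    obtain ⟨U, V, hUV, M, hM⟩ := exists_half_subset_image_prod hW hne
    obtain ⟨h1, h2⟩ := hM (max N M) (le_max_right _ _)
    obtain ⟨x, hx, hx'⟩ := exists_half_le_abs_iterate_sub_half h1
    obtain ⟨y, hy, hy'⟩ := exists_iterate_eq_half h2
    refine ⟨(x, y), hUV ⟨hx, hy⟩, max N M, le_max_left _ _, ?_⟩
    rw [edist_dist, ENNReal.ofReal_lt_ofReal_iff_of_nonneg (by norm_num), Subtype.dist_eq,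
      Real.dist_eq, hy']
    linarith

theorem genericallyChaotic_sqrtTent : GenericallyChaotic sqrtTent := by
  have h1 : ∀ᶠ p : unitInterval × unitInterval in residual _, ∀ k N : ℕ,
      ∃ n ≥ N, edist (sqrtTent^[n] p.1) (sqrtTent^[n] p.2) < ((k : ENNReal) + 1)⁻¹ :=
    eventually_countable_forall.2 fun k => eventually_countable_forall.2 fun N =>
      eventually_residual_edist_lt (by simp) N
  have h2 : ∀ᶠ p : unitInterval × unitInterval in residual _, ∀ N : ℕ,
      ∃ n ≥ N, ENNReal.ofReal (1 / 4) < edist (sqrtTent^[n] p.1) (sqrtTent^[n] p.2) :=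
    eventually_countable_forall.2 eventually_residual_lt_edist
  change ∀ᶠ p in residual _, p ∈ liYorkePairs sqrtTent
  filter_upwards [h1, h2] with p hp1 hp2
  -- Distances above 1/4 infinitely often only give an upper limit at least 1/4; a modulus of 1/8
  -- restores the strict inequality.
  refine ⟨1 / 8, by norm_num, ?_, ?_⟩
  · refine lt_of_lt_of_le ?_ (le_limsup_of_frequently_le'
      ((frequently_atTop.2 hp2).mono fun n hn => hn.le))
    rw [ENNReal.ofReal_lt_ofReal_iff_of_nonneg (by norm_num)]
    norm_num
  · refine le_antisymm (le_of_forall_pos_lt_add' ?_) bot_le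
    intro ε hε
    obtain ⟨k, hk⟩ := ENNReal.exists_inv_nat_lt hε.ne'
    have h := liminf_le_of_frequently_le'
      ((frequently_atTop.2 (hp1 k)).mono fun n hn => hn.le)
    rw [zero_add]
    refine h.trans_lt (lt_of_le_of_lt ?_ hk)
    exact ENNReal.inv_le_inv.2 le_self_add

/-! ### Periods -/

theorem iterate_even_sqrtTent_mem_half (n : ℕ) (x : unitInterval) :
    (1 / 2 ≤ (x : ℝ) → 1 / 2 ≤ ((sqrtTent^[2 * n] x : unitInterval) : ℝ)) ∧
      ((x : ℝ) ≤ 1 / 2 → ((sqrtTent^[2 * n] x : unitInterval) : ℝ) ≤ 1 / 2) := by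
  induction n with
  | zero => exact ⟨id, id⟩
  | succ n ih =>
    rw [mul_add_one, add_comm, iterate_add_apply]
    constructor <;> intro h
    · exact half_le_sqrtTentFun (sqrtTent _).2.1 (sqrtTentFun_le_half (ih.1 h))
    · exact sqrtTentFun_le_half (half_le_sqrtTentFun (sqrtTent^[2 * n] x).2.1 (ih.2 h))

/-- An odd iterate sends each half into the other, so a point it fixes lies in both. -/
theorem eq_half_of_isPeriodicPt_of_odd {n : ℕ} {x : unitInterval} (hn : Odd n)
    (h : IsPeriodicPt sqrtTent n x) : (x : ℝ) = 1 / 2 := by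
  obtain ⟨k, rfl⟩ := hn
  have h' : sqrtTent (sqrtTent^[2 * k] x) = x := by
    rw [← iterate_succ_apply' sqrtTent]
    exact h
  have h2 := iterate_even_sqrtTent_mem_half k x
  have h3 : sqrtTentFun (sqrtTent^[2 * k] x : unitInterval) = x := congrArg Subtype.val h'
  rcases le_total (1 / 2) (x : ℝ) with hx | hx
  · have := sqrtTentFun_le_half (h2.1 hx)
    linarith
  · have := half_le_sqrtTentFun (sqrtTent^[2 * k] x).2.1 (h2.2 hx)
    linarith

theorem isFixedPt_sqrtTent {x : unitInterval} (h : (x : ℝ) = 1 / 2) : IsFixedPt sqrtTent x := by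
  ext
  rw [coe_sqrtTent, sqrtTentFun_of_half_le h.ge, h]
  norm_num

theorem iterate_sqrtTentFun_half_add {t : ℝ} (j : ℕ) (ht : 0 ≤ t) (h : 2 ^ j * t ≤ 1) :
    sqrtTentFun^[2 * j] ((1 + t) / 2) = (1 + 2 ^ j * t) / 2 := by
  induction j with
  | zero => simp
  | succ j ih =>
    have h' : 2 ^ (j + 1) * t = 2 * (2 ^ j * t) := by ring
    have h0 : 0 ≤ 2 ^ j * t := by positivity
    rw [mul_add_one, add_comm, iterate_add_apply, ih (by linarith)]
    change sqrtTentFun (sqrtTentFun _) = _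
    rw [sqrtTentFun_sq_third (by linarith) (by linarith)]
    ring

/-- In the tent coordinate on the right half, take an orbit that climbs the increasing branch `k -
1` times and returns to its start by the decreasing branch. -/
theorem exists_minimalPeriod_sqrtTent_eq_two_mul {k : ℕ} (hk : 0 < k) :
    ∃ x : unitInterval, minimalPeriod sqrtTent x = 2 * k := by
  obtain ⟨j, rfl⟩ : ∃ j, k = j + 1 := ⟨k - 1, by omega⟩
  have h2j : (1 : ℝ) ≤ 2 ^ j := one_le_pow₀ (by norm_num)
  -- This is the closing condition `2 - 2 * (2 ^ j * t) = t`.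
  obtain ⟨t, ht⟩ : ∃ t : ℝ, t * (2 * 2 ^ j + 1) = 2 :=
    ⟨2 / (2 * 2 ^ j + 1), by field_simp⟩
  have ht0 : 0 < t := by
    by_contra! h
    nlinarith
  have hjt : 2 ^ j * t = 1 - t / 2 := by linarith
  have ht1 : t ≤ 1 := by nlinarith
  have hx : (1 + t) / 2 ∈ unitInterval := ⟨by linarith, by linarith⟩
  have hper : IsPeriodicPt sqrtTent (2 * (j + 1)) ⟨(1 + t) / 2, hx⟩ := by
    ext
    rw [coe_iterate_sqrtTent, mul_add_one, add_comm, iterate_add_apply,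
      iterate_sqrtTentFun_half_add j ht0.le (by linarith), hjt]
    change sqrtTentFun (sqrtTentFun _) = _
    rw [sqrtTentFun_sq_fourth (by linarith)]
    ring
  refine ⟨⟨(1 + t) / 2, hx⟩, ?_⟩
  have hpos := hper.minimalPeriod_pos (by omega)
  have hle := hper.minimalPeriod_le (by omega)
  have hmin := isPeriodicPt_minimalPeriod sqrtTent ⟨(1 + t) / 2, hx⟩
  generalize minimalPeriod sqrtTent ⟨(1 + t) / 2, hx⟩ = p at *
  -- A smaller even period `2 * i` would give `2 ^ i * t = t` with `i ≥ 1`; an odd period would put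
  -- the point at 1/2. Both contradict `0 < t`.
  obtain ⟨i, rfl | rfl⟩ := Nat.even_or_odd' p
  · by_contra hne
    have hij : i ≤ j := by omega
    have hpow : (2 : ℝ) ^ i ≤ 2 ^ j := pow_le_pow_right₀ (by norm_num) hij
    have h1 : (2 : ℝ) ≤ 2 ^ i := by
      simpa using pow_le_pow_right₀ (by norm_num : (1 : ℝ) ≤ 2) (show 1 ≤ i by omega)
    have h := congrArg Subtype.val hmin
    rw [coe_iterate_sqrtTent] at h
    change sqrtTentFun^[2 * i] ((1 + t) / 2) = (1 + t) / 2 at h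
    rw [iterate_sqrtTentFun_half_add i ht0.le (by nlinarith)] at h
    nlinarith
  · have h : (1 + t) / 2 = 1 / 2 := eq_half_of_isPeriodicPt_of_odd ⟨i, rfl⟩ hmin
    linarith

theorem periodSet_sqrtTent : periodSet sqrtTent = {m | 0 < m ∧ (m = 1 ∨ Even m)} := by
  ext m
  refine and_congr_right fun hm => ⟨?_, ?_⟩
  · rintro ⟨x, rfl⟩
    rcases Nat.even_or_odd (minimalPeriod sqrtTent x) with h | h
    · exact Or.inr h
    · exact Or.inl (minimalPeriod_eq_one_iff_isFixedPt.2 (isFixedPt_sqrtTent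
        (eq_half_of_isPeriodicPt_of_odd h (isPeriodicPt_minimalPeriod _ _))))
  · rintro (rfl | h)
    · exact ⟨⟨1 / 2, by norm_num, by norm_num⟩,
        minimalPeriod_eq_one_iff_isFixedPt.2 (isFixedPt_sqrtTent rfl)⟩
    · obtain ⟨k, rfl⟩ := h.two_dvd
      exact exists_minimalPeriod_sqrtTent_eq_two_mul (by omega)

theorem twoExp_two_pow_mul {a p : ℕ} (hp : Odd p) : twoExp (2 ^ a * p) = a := by
  rw [twoExp, padicValNat.mul (by positivity) hp.pos.ne', padicValNat.prime_pow,
    padicValNat.eq_zero_of_not_dvd hp.not_two_dvd_nat, add_zero]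

theorem oddFactor_two_pow_mul {a p : ℕ} (hp : Odd p) : oddFactor (2 ^ a * p) = p := by
  rw [oddFactor, twoExp_two_pow_mul hp, Nat.mul_div_cancel_left _ (by positivity)]

theorem eq_six_or_sharkovskiiLT_six_iff {m : ℕ} (hm : 0 < m) :
    m = 6 ∨ SharkovskiiLT 6 m ↔ m = 1 ∨ Even m := by
  have h6a : twoExp 6 = 1 := twoExp_two_pow_mul (a := 1) (p := 3) (by decide)
  have h6b : oddFactor 6 = 3 := oddFactor_two_pow_mul (a := 1) (p := 3) (by decide)
  obtain ⟨a, p, hp, rfl⟩ := Nat.exists_eq_two_pow_mul_odd hm.ne'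
  unfold SharkovskiiLT
  rw [h6a, h6b, twoExp_two_pow_mul hp, oddFactor_two_pow_mul hp]
  have hp' := Nat.odd_iff.1 hp
  rcases a with _ | _ | a
  · rw [pow_zero, one_mul, Nat.even_iff]
    omega
  · rw [zero_add, pow_one, Nat.even_iff]
    omega
  · have : Even (2 ^ (a + 1 + 1) * p) := by simp [Nat.even_pow]
    simp only [this, or_true, iff_true]
    right
    omega

theorem hasSharkovskiiType_sqrtTent : HasSharkovskiiType sqrtTent 6 := by
  refine ⟨by norm_num, ?_⟩
  rw [periodSet_sqrtTent]
  ext m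
  exact and_congr_right fun hm => (eq_six_or_sharkovskiiLT_six_iff hm).symm

/-! ### Dynamical covers -/

/-- `A` is a subset of `S` such that each orbit starting in `S` is `ε`-shadowed up to time `n` by
an orbit starting in `A`. -/
def IsOrbitCover (ε : ℝ) (n : ℕ) (S : Set ℝ) (A : Finset ℝ) : Prop :=
  ↑A ⊆ S ∧ ∀ x ∈ S, ∃ a ∈ A, ∀ k ≤ n, |sqrtTentFun^[k] x - sqrtTentFun^[k] a| ≤ ε

theorem forall_le_succ_iterate {ε x a : ℝ} {n : ℕ} (h0 : |x - a| ≤ ε)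
    (h : ∀ k ≤ n, |sqrtTentFun^[k] (sqrtTentFun x) - sqrtTentFun^[k] (sqrtTentFun a)| ≤ ε) :
    ∀ k ≤ n + 1, |sqrtTentFun^[k] x - sqrtTentFun^[k] a| ≤ ε := by
  rintro (_ | k) hk
  · exact h0
  · exact h k (by omega)

/-- The right half maps isometrically onto the left one, so pulling a cover back costs no extra
points. -/
theorem IsOrbitCover.right_of_left {ε : ℝ} {n : ℕ} {A : Finset ℝ}
    (h : IsOrbitCover ε n (Set.Icc 0 (1 / 2)) A) :
    ∃ B : Finset ℝ, B.card ≤ A.card ∧ IsOrbitCover ε (n + 1) (Set.Icc (1 / 2) 1) B := by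
  refine ⟨A.image fun a => 1 - a, Finset.card_image_le, ?_, ?_⟩
  · intro b hb
    obtain ⟨a, ha, rfl⟩ := Finset.mem_image.1 hb
    have := h.1 ha
    exact ⟨by linarith [this.2], by linarith [this.1]⟩
  · intro x hx
    have hgx := sqrtTentFun_of_half_le hx.1
    obtain ⟨a, ha, hxa⟩ := h.2 (sqrtTentFun x)
      (by rw [hgx]; exact ⟨by linarith [hx.2], by linarith [hx.1]⟩)
    have ha' : sqrtTentFun (1 - a) = a := by
      rw [sqrtTentFun_of_half_le (by linarith [(h.1 ha).2])]
      ring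
    refine ⟨1 - a, Finset.mem_image_of_mem _ ha, forall_le_succ_iterate ?_ ?_⟩
    · have h0 : |sqrtTentFun x - a| ≤ ε := hxa 0 (Nat.zero_le _)
      rw [hgx, abs_le] at h0
      rw [abs_le]
      constructor <;> linarith
    · rwa [ha']

/-- The left half folds twice over the right one: each point has two preimages, and the inverse
branches contract, so time 0 is controlled too. -/
theorem IsOrbitCover.left_of_right {ε : ℝ} {n : ℕ} {A : Finset ℝ}
    (h : IsOrbitCover ε n (Set.Icc (1 / 2) 1) A) :
    ∃ B : Finset ℝ, B.card ≤ 2 * A.card ∧ IsOrbitCover ε (n + 1) (Set.Icc 0 (1 / 2)) B := by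
  refine ⟨(A.image fun a => a / 2 - 1 / 4) ∪ A.image fun a => 3 / 4 - a / 2, ?_, ?_, ?_⟩
  · refine (Finset.card_union_le _ _).trans ?_
    rw [two_mul]
    exact add_le_add Finset.card_image_le Finset.card_image_le
  · intro b hb
    rcases Finset.mem_union.1 hb with hb | hb <;> obtain ⟨a, ha, rfl⟩ := Finset.mem_image.1 hb <;>
      have := h.1 ha <;> exact ⟨by linarith [this.1, this.2], by linarith [this.1, this.2]⟩
  · intro x hx
    rcases le_total x (1 / 4) with hx' | hx'
    · have hgx := sqrtTentFun_of_le_quarter hx'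
      obtain ⟨a, ha, hxa⟩ := h.2 (sqrtTentFun x)
        (by rw [hgx]; exact ⟨by linarith [hx.1], by linarith⟩)
      have ha' : sqrtTentFun (a / 2 - 1 / 4) = a := by
        rw [sqrtTentFun_of_le_quarter (by linarith [(h.1 ha).2])]
        ring
      refine ⟨a / 2 - 1 / 4, Finset.mem_union_left _ (Finset.mem_image_of_mem _ ha),
        forall_le_succ_iterate ?_ ?_⟩
      · have h0 : |sqrtTentFun x - a| ≤ ε := hxa 0 (Nat.zero_le _)
        rw [hgx, abs_le] at h0
        rw [abs_le]
        constructor <;> linarith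
      · rwa [ha']
    · have hgx := sqrtTentFun_of_mem_middle hx' hx.2
      obtain ⟨a, ha, hxa⟩ := h.2 (sqrtTentFun x)
        (by rw [hgx]; exact ⟨by linarith [hx.2], by linarith⟩)
      have ha' : sqrtTentFun (3 / 4 - a / 2) = a := by
        rw [sqrtTentFun_of_mem_middle (by linarith [(h.1 ha).2]) (by linarith [(h.1 ha).1])]
        ring
      refine ⟨3 / 4 - a / 2, Finset.mem_union_right _ (Finset.mem_image_of_mem _ ha),
        forall_le_succ_iterate ?_ ?_⟩
      · have h0 : |sqrtTentFun x - a| ≤ ε := hxa 0 (Nat.zero_le _)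
        rw [hgx, abs_le] at h0
        rw [abs_le]
        constructor <;> linarith
      · rwa [ha']

theorem exists_isOrbitCover_zero {ε : ℝ} (hε : 0 < ε) {S : Set ℝ} (hS : IsCompact S) :
    ∃ A : Finset ℝ, IsOrbitCover ε 0 S A := by
  obtain ⟨t, htS, htf, ht⟩ := finite_cover_balls_of_compact hS hε
  refine ⟨htf.toFinset, by simpa using htS, fun x hx => ?_⟩
  obtain ⟨a, ha, hxa⟩ := Set.mem_iUnion₂.1 (ht hx)
  refine ⟨a, by simpa using ha, fun k hk => ?_⟩
  rw [Nat.le_zero.1 hk]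
  exact (Metric.mem_ball.1 hxa).le

theorem exists_isOrbitCover_card_le {ε : ℝ} (hε : 0 < ε) : ∃ C : ℕ, 0 < C ∧ ∀ q : ℕ,
    ∃ A : Finset ℝ, A.card ≤ C * 2 ^ q ∧ IsOrbitCover ε (2 * q) (Set.Icc 0 1) A := by
  obtain ⟨A, hA⟩ := exists_isOrbitCover_zero hε (isCompact_Icc (a := (0 : ℝ)) (b := 1 / 2))
  obtain ⟨B, hB⟩ := exists_isOrbitCover_zero hε (isCompact_Icc (a := (1 / 2 : ℝ)) (b := 1))
  -- Two pullbacks return to the same half and pass through the fold exactly once, hence a factor 2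
  -- for two steps.
  have key : ∀ q : ℕ, ∃ A' B' : Finset ℝ, A'.card ≤ A.card * 2 ^ q ∧ B'.card ≤ B.card * 2 ^ q ∧
      IsOrbitCover ε (2 * q) (Set.Icc 0 (1 / 2)) A' ∧
      IsOrbitCover ε (2 * q) (Set.Icc (1 / 2) 1) B' := by
    intro q
    induction q with
    | zero => exact ⟨A, B, by simp, by simp, hA, hB⟩
    | succ q ih =>
      obtain ⟨A₁, B₁, hA₁, hB₁, hA₁', hB₁'⟩ := ih
      obtain ⟨A₂, hA₂, hA₂'⟩ := hB₁'.left_of_right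
      obtain ⟨B₂, hB₂, hB₂'⟩ := hA₁'.right_of_left
      obtain ⟨A₃, hA₃, hA₃'⟩ := hB₂'.left_of_right
      obtain ⟨B₃, hB₃, hB₃'⟩ := hA₂'.right_of_left
      refine ⟨A₃, B₃, ?_, ?_, hA₃', hB₃'⟩ <;> rw [pow_succ, ← mul_assoc] <;> omega
  refine ⟨A.card + B.card + 1, by omega, fun q => ?_⟩
  obtain ⟨A', B', hA', hB', hA'', hB''⟩ := key q
  refine ⟨A' ∪ B', ?_, ?_, ?_⟩
  · refine (Finset.card_union_le _ _).trans ((add_le_add hA' hB').trans ?_)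
    rw [← add_mul]
    exact Nat.mul_le_mul_right _ (by omega)
  · intro a ha
    rcases Finset.mem_union.1 ha with ha | ha
    · exact ⟨(hA''.1 ha).1, by linarith [(hA''.1 ha).2]⟩
    · exact ⟨by linarith [(hB''.1 ha).1], (hB''.1 ha).2⟩
  · intro x hx
    rcases le_total x (1 / 2) with h | h
    · obtain ⟨a, ha, hxa⟩ := hA''.2 x ⟨hx.1, h⟩
      exact ⟨a, Finset.mem_union_left _ ha, hxa⟩
    · obtain ⟨a, ha, hxa⟩ := hB''.2 x ⟨h, hx.2⟩
      exact ⟨a, Finset.mem_union_right _ ha, hxa⟩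

theorem exists_finset_unitInterval {A : Finset ℝ} (hA : (A : Set ℝ) ⊆ unitInterval) :
    ∃ B : Finset unitInterval, B.card = A.card ∧ ∀ b : unitInterval, b ∈ B ↔ (b : ℝ) ∈ A :=
  ⟨A.subtype (· ∈ unitInterval),
    by rw [Finset.card_subtype, Finset.filter_true_of_mem fun a ha => hA ha], by simp⟩

theorem coverEntropy_sqrtTent_le :
    Dynamics.coverEntropy sqrtTent Set.univ ≤ ((Real.log 2 / 2 : ℝ) : EReal) := by
  refine iSup₂_le fun U hU => ?_
  obtain ⟨V, hV, hVU⟩ := comp_mem_uniformity_sets hU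
  obtain ⟨ε, hε, hεV⟩ := Metric.mem_uniformity_dist.1 hV
  let W : SetRel unitInterval unitInterval := {p | dist p.1 p.2 < ε}
  have hWsymm : W.IsSymm := ⟨fun a b (h : dist a b < ε) => by
    change dist b a < ε
    rwa [dist_comm]⟩
  have hWU : SetRel.comp W W ⊆ U := by
    rintro ⟨a, b⟩ ⟨c, hac, hcb⟩
    exact hVU ⟨c, hεV hac, hεV hcb⟩
  obtain ⟨C, hC, hcov⟩ := exists_isOrbitCover_card_le (half_pos hε)
  -- A cover at a single positive time already bounds the entropy, at the cost of passing from `W`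
  -- to `W` composed with itself; so even times suffice.
  have bound : ∀ q : ℕ, Dynamics.coverEntropyEntourage sqrtTent Set.univ U ≤
      ((Real.log C / (2 * ((q + 1 : ℕ) : ℝ)) + Real.log 2 / 2 : ℝ) : EReal) := by
    intro q
    obtain ⟨A, hAc, hA⟩ := hcov (q + 1)
    obtain ⟨B, hBc, hB⟩ := exists_finset_unitInterval hA.1
    have hdyn : Dynamics.IsDynCoverOf sqrtTent Set.univ W (2 * (q + 1)) (B : Set unitInterval) := by
      intro x _
      obtain ⟨a, ha, hxa⟩ := hA.2 x x.2
      refine ⟨⟨a, hA.1 ha⟩, (hB _).2 ha, Dynamics.mem_dynEntourage.2 fun k hk => ?_⟩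
      change dist _ _ < ε
      rw [Subtype.dist_eq, Real.dist_eq, coe_iterate_sqrtTent, coe_iterate_sqrtTent]
      exact (hxa k hk.le).trans_lt (half_lt_self hε)
    refine (Dynamics.coverEntropyEntourage_antitone _ _ hWU).trans
      ((hdyn.coverEntropyEntourage_le_log_card_div (Set.mapsTo_univ _ _) (by omega)).trans ?_)
    have hcard : ((B.card : ℕ) : ENNReal) ≤ ENNReal.ofReal (C * 2 ^ (q + 1)) := by
      rw [← ENNReal.ofReal_natCast]
      refine ENNReal.ofReal_le_ofReal ?_
      rw [hBc]
      exact_mod_cast hAc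
    have hlog := ENNReal.log_monotone hcard
    have hCpos : (0 : ℝ) < C := by exact_mod_cast hC
    rw [ENNReal.log_ofReal_of_pos (by positivity)] at hlog
    refine (EReal.div_le_div_right_of_nonneg (by positivity) hlog).trans (le_of_eq ?_)
    rw [← EReal.coe_natCast, ← EReal.coe_div, Real.log_mul (by positivity) (by positivity),
      Real.log_pow]
    congr 1
    push_cast
    field_simp
  refine ge_of_tendsto' (x := atTop) ?_ bound
  refine (continuous_coe_real_ereal.tendsto _).comp ?_
  have h1 : Tendsto (fun q : ℕ => Real.log C / (2 * ((q + 1 : ℕ) : ℝ))) atTop (nhds 0) :=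
    tendsto_const_nhds.div_atTop (Tendsto.const_mul_atTop (by norm_num)
      (tendsto_natCast_atTop_atTop.comp (tendsto_add_atTop_nat 1)))
  simpa using h1.add_const (Real.log 2 / 2)

/-! ### Separated sets -/

/-- Distinct points of `A` are at distance at least `δ` at some time before `n`. -/
def IsOrbitSeparated (δ : ℝ) (n : ℕ) (A : Finset ℝ) : Prop :=
  ∀ x ∈ A, ∀ y ∈ A, x ≠ y → ∃ k < n, δ ≤ |sqrtTentFun^[k] x - sqrtTentFun^[k] y|

theorem exists_lt_add_two {δ x y : ℝ} {n : ℕ}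
    (h : ∃ k < n, δ ≤ |sqrtTentFun^[k] (sqrtTentFun (sqrtTentFun x)) -
      sqrtTentFun^[k] (sqrtTentFun (sqrtTentFun y))|) :
    ∃ k < n + 2, δ ≤ |sqrtTentFun^[k] x - sqrtTentFun^[k] y| := by
  obtain ⟨k, hk, h⟩ := h
  exact ⟨k + 2, by omega, h⟩

theorem sqrtTentFun_sq_lower_branch {x : ℝ} (h0 : 1 / 2 ≤ x) (h1 : x ≤ 1) :
    sqrtTentFun (sqrtTentFun (1 / 4 + x / 2)) = x := by
  rw [sqrtTentFun_sq_third (by linarith) (by linarith)]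
  ring

theorem sqrtTentFun_sq_upper_branch {x : ℝ} (h1 : x ≤ 1) :
    sqrtTentFun (sqrtTentFun (5 / 4 - x / 2)) = x := by
  rw [sqrtTentFun_sq_fourth (by linarith)]
  ring

/-- Pulling a separated set back by both inverse branches of the square of the map. -/
theorem IsOrbitSeparated.exists_double {δ d : ℝ} {n : ℕ} {A : Finset ℝ}
    (h : IsOrbitSeparated δ n A) (hd : 0 < d) (hδ : δ ≤ d)
    (hA : (A : Set ℝ) ⊆ Set.Icc (1 / 2 + d) (1 - d)) :
    ∃ B : Finset ℝ, B.card = 2 * A.card ∧ (B : Set ℝ) ⊆ Set.Icc (1 / 2 + d / 2) (1 - d / 2) ∧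
      IsOrbitSeparated δ (n + 2) B := by
  have hA0 : ∀ a ∈ A, 1 / 2 + d ≤ a := fun a ha => (hA ha).1
  have hA1 : ∀ a ∈ A, a ≤ 1 - d := fun a ha => (hA ha).2
  refine ⟨(A.image fun a => 1 / 4 + a / 2) ∪ A.image fun a => 5 / 4 - a / 2, ?_, ?_, ?_⟩
  · rw [Finset.card_union_of_disjoint, Finset.card_image_of_injective,
      Finset.card_image_of_injective, two_mul]
    · intro a b hab
      simp only at hab
      linarith
    · intro a b hab
      simp only at hab
      linarith
    · rw [Finset.disjoint_left]
      intro x hx hx'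
      obtain ⟨a, ha, rfl⟩ := Finset.mem_image.1 hx
      obtain ⟨b, hb, hab⟩ := Finset.mem_image.1 hx'
      linarith [hA1 a ha, hA1 b hb]
  · intro x hx
    rcases Finset.mem_union.1 hx with hx | hx <;> obtain ⟨a, ha, rfl⟩ := Finset.mem_image.1 hx <;>
      exact ⟨by linarith [hA0 a ha, hA1 a ha], by linarith [hA0 a ha, hA1 a ha]⟩
  · intro x hx y hy hxy
    rcases Finset.mem_union.1 hx with hx | hx <;> rcases Finset.mem_union.1 hy with hy | hy <;>
      obtain ⟨a, ha, rfl⟩ := Finset.mem_image.1 hx <;>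
      obtain ⟨b, hb, rfl⟩ := Finset.mem_image.1 hy <;>
      have ha0 := hA0 a ha <;> have ha1 := hA1 a ha <;>
      have hb0 := hA0 b hb <;> have hb1 := hA1 b hb
    · apply exists_lt_add_two
      rw [sqrtTentFun_sq_lower_branch (by linarith) (by linarith),
        sqrtTentFun_sq_lower_branch (by linarith) (by linarith)]
      exact h a ha b hb fun hab => hxy (by rw [hab])
    -- The two branch images meet only near 3/4; the margin `d` keeps them on opposite sides, at
    -- distance at least `d` already at time 0.
    · exact ⟨0, by omega, le_abs.2 (Or.inr (by simp only [iterate_zero, id]; linarith))⟩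
    · exact ⟨0, by omega, le_abs.2 (Or.inl (by simp only [iterate_zero, id]; linarith))⟩
    · apply exists_lt_add_two
      rw [sqrtTentFun_sq_upper_branch (by linarith), sqrtTentFun_sq_upper_branch (by linarith)]
      exact h a ha b hb fun hab => hxy (by rw [hab])

/-- Pulling a separated set back into the interior of the right half. -/
theorem IsOrbitSeparated.exists_interior {δ : ℝ} {n : ℕ} {A : Finset ℝ}
    (h : IsOrbitSeparated δ n A) (hA : (A : Set ℝ) ⊆ Set.Icc (1 / 2) 1) :
    ∃ B : Finset ℝ, B.card = A.card ∧ (B : Set ℝ) ⊆ Set.Icc (1 / 2 + 1 / 8) (1 - 1 / 8) ∧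
      IsOrbitSeparated δ (n + 4) B := by
  have hA0 : ∀ a ∈ A, 1 / 2 ≤ a := fun a ha => (hA ha).1
  have hA1 : ∀ a ∈ A, a ≤ 1 := fun a ha => (hA ha).2
  -- Upper branch, then lower branch: [1/2, 1] goes to [3/4, 1] and then to [5/8, 3/4].
  refine ⟨A.image fun a => 1 / 4 + (5 / 4 - a / 2) / 2, ?_, ?_, ?_⟩
  · refine Finset.card_image_of_injective _ fun a b hab => ?_
    linarith
  · intro x hx
    obtain ⟨a, ha, rfl⟩ := Finset.mem_image.1 hx
    exact ⟨by linarith [hA0 a ha, hA1 a ha], by linarith [hA0 a ha, hA1 a ha]⟩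
  · intro x hx y hy hxy
    obtain ⟨a, ha, rfl⟩ := Finset.mem_image.1 hx
    obtain ⟨b, hb, rfl⟩ := Finset.mem_image.1 hy
    have ha0 := hA0 a ha
    have ha1 := hA1 a ha
    have hb0 := hA0 b hb
    have hb1 := hA1 b hb
    apply exists_lt_add_two (n := n + 2)
    rw [sqrtTentFun_sq_lower_branch (by linarith) (by linarith),
      sqrtTentFun_sq_lower_branch (by linarith) (by linarith)]
    apply exists_lt_add_two
    rw [sqrtTentFun_sq_upper_branch ha1, sqrtTentFun_sq_upper_branch hb1]
    exact h a ha b hb fun hab => hxy (by rw [hab])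

/-- Doubling needs a margin from the ends of the half and halves that margin. Four steps buy an
initial margin 1/8, and `m` doublings then keep the scale above `δ`. -/
theorem IsOrbitSeparated.exists_two_pow {δ : ℝ} {n : ℕ} {A : Finset ℝ}
    (h : IsOrbitSeparated δ n A) (hA : (A : Set ℝ) ⊆ Set.Icc (1 / 2) 1) (m : ℕ)
    (hδ : δ ≤ 1 / 8 / 2 ^ m) :
    ∃ B : Finset ℝ, B.card = 2 ^ m * A.card ∧
      (B : Set ℝ) ⊆ Set.Icc (1 / 2 + 1 / 8 / 2 ^ m) (1 - 1 / 8 / 2 ^ m) ∧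
      IsOrbitSeparated δ (n + (2 * m + 4)) B := by
  induction m with
  | zero => simpa using h.exists_interior hA
  | succ m ih =>
    have h2 : (1 / 8 / 2 ^ (m + 1) : ℝ) = 1 / 8 / 2 ^ m / 2 := by
      rw [pow_succ, ← div_div]
    have hpos : (0 : ℝ) < 1 / 8 / 2 ^ m := by positivity
    rw [h2] at hδ ⊢
    have hδ' : δ ≤ 1 / 8 / 2 ^ m := by linarith
    obtain ⟨B, hBc, hB, hBs⟩ := ih hδ'
    obtain ⟨D, hDc, hD, hDs⟩ := hBs.exists_double hpos hδ' hB
    exact ⟨D, by rw [hDc, hBc]; ring, hD, hDs⟩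

/-- The separation must not depend on `k`, so the margin is restored after each block of `m`
doublings. The four steps lost per block are negligible for large `m`. -/
theorem exists_isOrbitSeparated (m k : ℕ) : ∃ A : Finset ℝ, A.card = 2 ^ (m * k) ∧
    (A : Set ℝ) ⊆ Set.Icc (1 / 2) 1 ∧ IsOrbitSeparated (1 / 8 / 2 ^ m) ((2 * m + 4) * k) A := by
  induction k with
  | zero =>
    refine ⟨{1}, by simp, by norm_num, fun x hx y hy hxy => ?_⟩
    rw [Finset.mem_singleton.1 hx, Finset.mem_singleton.1 hy] at hxy
    exact absurd rfl hxy
  | succ k ih =>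
    obtain ⟨A, hAc, hA, hAs⟩ := ih
    obtain ⟨B, hBc, hB, hBs⟩ := hAs.exists_two_pow hA m le_rfl
    have hpos : (0 : ℝ) < 1 / 8 / 2 ^ m := by positivity
    exact ⟨B, by rw [hBc, hAc]; ring,
      hB.trans (Set.Icc_subset_Icc (by linarith) (by linarith)), hBs⟩

theorem le_coverEntropy_sqrtTent (m : ℕ) :
    ((m * Real.log 2 / (2 * m + 4) : ℝ) : EReal) ≤ Dynamics.coverEntropy sqrtTent Set.univ := by
  let δ : ℝ := 1 / 8 / 2 ^ m
  have hδ : 0 < δ / 2 := by positivity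
  -- Dynamical nets require disjoint balls, so the radius is half the separation.
  let W : SetRel unitInterval unitInterval := {p | dist p.1 p.2 < δ / 2}
  have hW : W ∈ uniformity unitInterval := Metric.dist_mem_uniformity hδ
  refine le_trans ?_ (Dynamics.netEntropyEntourage_le_coverEntropy _ _ hW)
  -- The net entropy is an upper limit, so the multiples of `2 * m + 4` suffice.
  refine le_limsup_of_frequently_le' (frequently_atTop.2 fun N => ?_)
  refine ⟨(2 * m + 4) * (N + 1), by nlinarith, ?_⟩
  obtain ⟨A, hAc, hA, hAs⟩ := exists_isOrbitSeparated m (N + 1)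
  obtain ⟨B, hBc, hB⟩ := exists_finset_unitInterval
    (hA.trans (Set.Icc_subset_Icc (by norm_num) le_rfl))
  have hnet : Dynamics.IsDynNetIn sqrtTent Set.univ W ((2 * m + 4) * (N + 1))
      (B : Set unitInterval) := by
    refine ⟨Set.subset_univ _, fun x hx y hy hxy => Set.disjoint_left.2 fun z hzx hzy => ?_⟩
    obtain ⟨k, hk, hsep⟩ := hAs x ((hB x).1 hx) y ((hB y).1 hy) fun h => hxy (Subtype.ext h)
    have h1 : dist (sqrtTent^[k] x) (sqrtTent^[k] z) < δ / 2 :=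
      Dynamics.mem_ball_dynEntourage.1 hzx k hk
    have h2 : dist (sqrtTent^[k] y) (sqrtTent^[k] z) < δ / 2 :=
      Dynamics.mem_ball_dynEntourage.1 hzy k hk
    have h3 := dist_triangle_right (sqrtTent^[k] x) (sqrtTent^[k] y) (sqrtTent^[k] z)
    rw [← coe_iterate_sqrtTent, ← coe_iterate_sqrtTent, ← Real.dist_eq, ← Subtype.dist_eq] at hsep
    change δ ≤ _ at hsep
    linarith
  have hcard : ENNReal.ofReal (2 ^ (m * (N + 1))) ≤
      (Dynamics.netMaxcard sqrtTent Set.univ W ((2 * m + 4) * (N + 1)) : ENNReal) := by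
    have h := ENat.toENNReal_mono hnet.card_le_netMaxcard
    rw [hBc, hAc] at h
    refine le_trans (le_of_eq ?_) h
    rw [ENat.toENNReal_coe, ← ENNReal.ofReal_natCast]
    norm_num
  have hlog := ENNReal.log_monotone hcard
  rw [ENNReal.log_ofReal_of_pos (by positivity)] at hlog
  refine le_trans (le_of_eq ?_) (EReal.div_le_div_right_of_nonneg (by positivity) hlog)
  rw [← EReal.coe_natCast, ← EReal.coe_div, Real.log_pow]
  congr 1
  push_cast
  field_simp

theorem coverEntropy_sqrtTent :
    Dynamics.coverEntropy sqrtTent Set.univ = ((Real.log 2 / 2 : ℝ) : EReal) := by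
  refine le_antisymm coverEntropy_sqrtTent_le ?_
  refine le_of_tendsto' (x := atTop) ?_ le_coverEntropy_sqrtTent
  refine (continuous_coe_real_ereal.tendsto _).comp ?_
  have h1 : Tendsto (fun m : ℕ => Real.log 2 / ((m : ℝ) + 2)) atTop (nhds 0) :=
    tendsto_const_nhds.div_atTop (tendsto_atTop_add_const_right _ _ tendsto_natCast_atTop_atTop)
  have h2 := h1.const_sub (Real.log 2 / 2)
  rw [sub_zero] at h2
  refine h2.congr fun m => ?_
  field_simp
  ring

end DenseChaos

open DenseChaos in
theorem mainTheorem3 :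
    -- the map exchanges the two halves of the interval
    (sqrtTent '' {x : unitInterval | (x : ℝ) ≤ 1 / 2} = {x : unitInterval | 1 / 2 ≤ (x : ℝ)} ∧
      sqrtTent '' {x : unitInterval | 1 / 2 ≤ (x : ℝ)} = {x : unitInterval | (x : ℝ) ≤ 1 / 2}) ∧
    -- its square is the tent map on the right half, and the tent map upside down on the left half
    (∀ t x : unitInterval, (x : ℝ) = (1 + t) / 2 →
      (sqrtTent (sqrtTent x) : ℝ) = (1 + tentMap t) / 2) ∧
    (∀ t x : unitInterval, (x : ℝ) = (1 - t) / 2 →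
      (sqrtTent (sqrtTent x) : ℝ) = (1 - tentMap t) / 2) ∧
    IsTransitiveMap sqrtTent ∧
    GenericallyChaotic sqrtTent ∧
    DenselyChaotic sqrtTent ∧
    HasSharkovskiiType sqrtTent 6 ∧
    Dynamics.coverEntropy sqrtTent Set.univ = ((Real.log 2 / 2 : ℝ) : EReal) := by
  exact ⟨⟨sqrtTent_image_left, sqrtTent_image_right⟩, sqrtTent_sq_right, sqrtTent_sq_left,
    isTransitiveMap_sqrtTent, genericallyChaotic_sqrtTent,
    dense_of_mem_residual genericallyChaotic_sqrtTent, hasSharkovskiiType_sqrtTent,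
    coverEntropy_sqrtTent⟩
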